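/- Let $\Bbbk$ be a field of characteristic zero and let $W_+$ be the positive Witt algebra over $\Bbbk$, that is, the Lie algebra with basis $\{e_n : n \in \mathbb{Z}_{\geq 1}\}$ and bracket $[e_i,e_j]=(j-i)e_{i+j}$. Equip the symmetric algebra $\mathrm{S}(W_+)$ with the Poisson bracket $\{\cdot,\cdot\}$ that extends the Lie bracket of $W_+$, i.e. the unique biderivation with $\{x,y\}=[x,y]$ for $x,y\in W_+$. An ideal $I$ of $\mathrm{S}(W_+)$ is called Poisson if $\{a,f\}\in I$ for all $a\in \mathrm{S}(W_+)$ and $f\in I$; the Poisson ideal generated by a set $X$ is the smallest Poisson ideal that contains $X$; and a quadratic element is an element of $\mathrm{S}^2(W_+)$, the span of the products of two elements of $W_+$. Then $\mathrm{S}(W_+)$ satisfies the ascending chain condition on Poisson ideals generated by quadratic elements: if $I_0\subseteq I_1\subseteq I_2\subseteq\cdots$ is a chain of ideals of $\mathrm{S}(W_+)$, each of which is the Poisson ideal generated by some set of elements of $\mathrm{S}^2(W_+)$, then there is $N$ such that $I_n=I_N$ for all $n\geq N$. -/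

import Mathlib

noncomputable section

/-- The positive Witt algebra `W₊` over `k`, as the vector space with basis `e n`, `n ≥ 1`. -/
def PositiveWitt (k : Type*) [Field k] : Type _ := ℕ+ →₀ k

namespace PositiveWitt

variable (k : Type*) [Field k]

instance : AddCommGroup (PositiveWitt k) := inferInstanceAs (AddCommGroup (ℕ+ →₀ k))

instance : Module k (PositiveWitt k) := inferInstanceAs (Module k (ℕ+ →₀ k))

/-- The basis `e n`, `n ≥ 1`, of the positive Witt algebra. -/
def e : Module.Basis ℕ+ k (PositiveWitt k) := Module.Basis.ofRepr (LinearEquiv.refl k (ℕ+ →₀ k))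

/-- The bilinear map with `(e i, e j) ↦ (j - i) e (i + j)`. -/
def lieHom : PositiveWitt k →ₗ[k] PositiveWitt k →ₗ[k] PositiveWitt k :=
  (e k).constr k fun i => (e k).constr k fun j => (((j : ℕ) : k) - ((i : ℕ) : k)) • e k (i + j)

theorem lieHom_e (i j : ℕ+) :
    lieHom k (e k i) (e k j) = (((j : ℕ) : k) - ((i : ℕ) : k)) • e k (i + j) := by
  simp [lieHom]

theorem lieHom_skew (x y : PositiveWitt k) : lieHom k x y = -lieHom k y x := by
  have h : lieHom k = -(lieHom k).flip := by
    refine (e k).ext fun i => (e k).ext fun j => ?_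
    simp only [LinearMap.neg_apply, LinearMap.flip_apply, lieHom_e, add_comm j i, ← neg_smul]
    congr 1
    ring
  exact congr($h x y)

theorem lieHom_leibniz (x y z : PositiveWitt k) :
    lieHom k x (lieHom k y z) = lieHom k (lieHom k x y) z + lieHom k y (lieHom k x z) := by
  induction (e k).mem_span x using Submodule.span_induction with
  | zero => simp
  | add x x' _ _ hx hx' => simp only [map_add, LinearMap.add_apply, hx, hx']; abel
  | smul c x _ hx => simp only [map_smul, LinearMap.smul_apply, hx, smul_add]
  | mem x hx =>
  obtain ⟨i, rfl⟩ := hx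
  induction (e k).mem_span y using Submodule.span_induction with
  | zero => simp
  | add x x' _ _ hx hx' => simp only [map_add, LinearMap.add_apply, hx, hx']; abel
  | smul c x _ hx => simp only [map_smul, LinearMap.smul_apply, hx, smul_add]
  | mem x hx =>
  obtain ⟨j, rfl⟩ := hx
  induction (e k).mem_span z using Submodule.span_induction with
  | zero => simp
  | add x x' _ _ hx hx' => simp only [map_add, hx, hx']; abel
  | smul c x _ hx => simp only [map_smul, hx, smul_add]
  | mem x hx =>
  obtain ⟨l, rfl⟩ := hx
  simp only [lieHom_e, map_smul, LinearMap.smul_apply, smul_smul, add_assoc, add_left_comm j i l,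
    ← add_smul]
  congr 1
  push_cast
  ring

variable [CharZero k]

/-- The Lie bracket on the positive Witt algebra: `⁅e i, e j⁆ = (j - i) e (i + j)`. -/
instance : LieRing (PositiveWitt k) where
  bracket x y := lieHom k x y
  add_lie x y z := by simp
  lie_add x y z := by simp
  lie_self x := by
    have h : (2 : k) • lieHom k x x = 0 := by
      rw [two_smul]
      nth_rewrite 1 [lieHom_skew]
      exact neg_add_cancel _
    exact (smul_eq_zero.mp h).resolve_left two_ne_zero
  leibniz_lie := lieHom_leibniz k

instance : LieAlgebra k (PositiveWitt k) where
  __ := (inferInstance : Module k (PositiveWitt k))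
  lie_smul t x y := map_smul (lieHom k x) t y

end PositiveWitt

namespace SymmetricAlgebra

variable {k L : Type*} [Field k]

section Derivation

variable [AddCommGroup L] [Module k L]

/-- The algebra homomorphism `a ↦ a + D a ε` to the dual numbers, where `D` is the derivation
extending `φ`. -/
def toDual (φ : L →ₗ[k] SymmetricAlgebra k L) :
    SymmetricAlgebra k L →ₐ[k] TrivSqZeroExt (SymmetricAlgebra k L) (SymmetricAlgebra k L) :=
  lift ((TrivSqZeroExt.inlAlgHom k (SymmetricAlgebra k L) (SymmetricAlgebra k L)).toLinearMap ∘ₗ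
      ι k L +
    (TrivSqZeroExt.inrHom (SymmetricAlgebra k L) (SymmetricAlgebra k L)).restrictScalars k ∘ₗ φ)

theorem fst_toDual (φ : L →ₗ[k] SymmetricAlgebra k L) (a : SymmetricAlgebra k L) :
    (toDual φ a).fst = a := by
  have h : (TrivSqZeroExt.fstHom k (SymmetricAlgebra k L) (SymmetricAlgebra k L)).comp (toDual φ) =
      AlgHom.id k _ := by
    ext x
    simp [toDual]
  exact congr($h a)

/-- The unique derivation of the symmetric algebra that extends a given linear map on `L`. -/
def extendDerivation (φ : L →ₗ[k] SymmetricAlgebra k L) :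
    Derivation k (SymmetricAlgebra k L) (SymmetricAlgebra k L) :=
  Derivation.mk'
    ((TrivSqZeroExt.sndHom (SymmetricAlgebra k L) (SymmetricAlgebra k L)).restrictScalars k ∘ₗ
      (toDual φ).toLinearMap)
    fun a b => by simp [fst_toDual, mul_comm]

@[simp]
theorem extendDerivation_ι (φ : L →ₗ[k] SymmetricAlgebra k L) (x : L) :
    extendDerivation φ (ι k L x) = φ x := by
  simp [extendDerivation, toDual]

theorem derivation_ext {D₁ D₂ : Derivation k (SymmetricAlgebra k L) (SymmetricAlgebra k L)}
    (h : ∀ x, D₁ (ι k L x) = D₂ (ι k L x)) : D₁ = D₂ := by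
  ext a
  induction a using SymmetricAlgebra.induction with
  | algebraMap r => simp
  | ι x => exact h x
  | mul a b ha hb => simp [ha, hb]
  | add a b ha hb => simp [ha, hb]

end Derivation

variable [LieRing L] [LieAlgebra k L]

/-- The action of `L` on its symmetric algebra by derivations that extends the adjoint action. -/
def adDerivation :
    L →ₗ[k] Derivation k (SymmetricAlgebra k L) (SymmetricAlgebra k L) where
  toFun x := extendDerivation (ι k L ∘ₗ LieAlgebra.ad k L x)
  map_add' x y := derivation_ext fun z => by simp
  map_smul' c x := derivation_ext fun z => by simp

@[simp]
theorem adDerivation_ι (x y : L) :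
    adDerivation x (ι k L y) = ι k L ⁅x, y⁆ := by
  simp [adDerivation]

/-- For fixed `b`, the derivation `a ↦ {a, b}`: it sends `ι x` to `adDerivation x b`. -/
def poissonLeft (b : SymmetricAlgebra k L) :
    Derivation k (SymmetricAlgebra k L) (SymmetricAlgebra k L) :=
  extendDerivation
    { toFun := fun x => adDerivation x b
      map_add' := fun x y => by simp
      map_smul' := fun c x => by simp }

/-- The Poisson bracket `{a, b}` on the symmetric algebra of a Lie algebra: the unique biderivation
that extends the Lie bracket. -/
def poissonBracket (a b : SymmetricAlgebra k L) : SymmetricAlgebra k L := poissonLeft b a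

theorem poissonBracket_ι_left (x : L) (b : SymmetricAlgebra k L) :
    poissonBracket (ι k L x) b = adDerivation x b := by
  simp [poissonBracket, poissonLeft]

theorem poissonBracket_ι_ι (x y : L) :
    poissonBracket (ι k L x) (ι k L y) = ι k L ⁅x, y⁆ := by
  simp [poissonBracket_ι_left]

theorem poissonBracket_add_left (a b c : SymmetricAlgebra k L) :
    poissonBracket (a + b) c = poissonBracket a c + poissonBracket b c :=
  map_add (poissonLeft c) a b

theorem poissonBracket_mul_left (a b c : SymmetricAlgebra k L) :
    poissonBracket (a * b) c = a * poissonBracket b c + b * poissonBracket a c :=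
  (poissonLeft c).leibniz a b

theorem poissonBracket_algebraMap_left (r : k) (c : SymmetricAlgebra k L) :
    poissonBracket (algebraMap k _ r) c = 0 :=
  (poissonLeft c).map_algebraMap r

theorem poissonBracket_add_right (a b c : SymmetricAlgebra k L) :
    poissonBracket a (b + c) = poissonBracket a b + poissonBracket a c := by
  have h : poissonLeft (b + c) = poissonLeft b + poissonLeft c :=
    derivation_ext fun x => by simp [poissonLeft]
  exact congr($h a)

theorem poissonBracket_mul_right (a b c : SymmetricAlgebra k L) :
    poissonBracket a (b * c) = b * poissonBracket a c + c * poissonBracket a b := by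
  have h : poissonLeft (b * c) = b • poissonLeft c + c • poissonLeft b :=
    derivation_ext fun x => by simp [poissonLeft]
  exact congr($h a)

theorem poissonBracket_algebraMap_right (a : SymmetricAlgebra k L) (r : k) :
    poissonBracket a (algebraMap k _ r) = 0 := by
  have h : poissonLeft (algebraMap k (SymmetricAlgebra k L) r) = 0 :=
    derivation_ext fun x => by simp [poissonLeft]
  exact congr($h a)

theorem poissonBracket_zero_left (c : SymmetricAlgebra k L) : poissonBracket 0 c = 0 :=
  map_zero (poissonLeft c)

theorem poissonBracket_zero_right (a : SymmetricAlgebra k L) : poissonBracket a 0 = 0 := by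
  simpa using poissonBracket_algebraMap_right a 0

theorem poissonBracket_skew (a b : SymmetricAlgebra k L) :
    poissonBracket a b = -poissonBracket b a := by
  induction a using SymmetricAlgebra.induction with
  | algebraMap r => simp [poissonBracket_algebraMap_left, poissonBracket_algebraMap_right]
  | mul a a' h h' => rw [poissonBracket_mul_left, poissonBracket_mul_right, h, h']; ring
  | add a a' h h' => rw [poissonBracket_add_left, poissonBracket_add_right, h, h']; ring
  | ι x =>
  induction b using SymmetricAlgebra.induction with
  | algebraMap r => simp [poissonBracket_algebraMap_left, poissonBracket_algebraMap_right]
  | mul a a' h h' => rw [poissonBracket_mul_left, poissonBracket_mul_right, h, h']; ring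
  | add a a' h h' => rw [poissonBracket_add_left, poissonBracket_add_right, h, h']; ring
  | ι y => rw [poissonBracket_ι_ι, poissonBracket_ι_ι, ← map_neg, lie_skew]

theorem poissonBracket_jacobi (a b c : SymmetricAlgebra k L) :
    poissonBracket a (poissonBracket b c) =
      poissonBracket (poissonBracket a b) c + poissonBracket b (poissonBracket a c) := by
  induction a using SymmetricAlgebra.induction with
  | algebraMap r =>
    simp only [poissonBracket_algebraMap_left, poissonBracket_zero_left,
      poissonBracket_zero_right, add_zero]
  | mul a a' h h' =>
    simp only [poissonBracket_mul_left, poissonBracket_mul_right, poissonBracket_add_left,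
      poissonBracket_add_right, h, h', poissonBracket_skew b a, poissonBracket_skew b a']
    ring
  | add a a' h h' =>
    simp only [poissonBracket_add_left, poissonBracket_add_right, h, h']
    ring
  | ι x =>
  induction b using SymmetricAlgebra.induction with
  | algebraMap r =>
    simp only [poissonBracket_algebraMap_left, poissonBracket_algebraMap_right,
      poissonBracket_zero_left, poissonBracket_zero_right, add_zero]
  | mul a a' h h' =>
    simp only [poissonBracket_mul_left, poissonBracket_mul_right, poissonBracket_add_left,
      poissonBracket_add_right, h, h']
    ring
  | add a a' h h' =>
    simp only [poissonBracket_add_left, poissonBracket_add_right, h, h']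
    ring
  | ι y =>
  induction c using SymmetricAlgebra.induction with
  | algebraMap r =>
    simp only [poissonBracket_algebraMap_right, poissonBracket_zero_right, add_zero]
  | mul a a' h h' =>
    simp only [poissonBracket_mul_right,
      poissonBracket_add_right, h, h']
    ring
  | add a a' h h' =>
    simp only [poissonBracket_add_right, h, h']
    ring
  | ι z =>
    simp only [poissonBracket_ι_ι, ← map_add]
    rw [leibniz_lie]

/-- An ideal `I` of the symmetric algebra of a Lie algebra is Poisson if `{a, f} ∈ I` for all `a`
and all `f ∈ I`. -/
def IsPoissonIdeal (I : Ideal (SymmetricAlgebra k L)) : Prop :=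
  ∀ a : SymmetricAlgebra k L, ∀ f ∈ I, poissonBracket a f ∈ I

/-- The Poisson ideal generated by a set `X`: the smallest Poisson ideal containing `X`. -/
def poissonSpan (X : Set (SymmetricAlgebra k L)) : Ideal (SymmetricAlgebra k L) :=
  sInf {I | IsPoissonIdeal I ∧ X ⊆ I}

theorem isPoissonIdeal_poissonSpan (X : Set (SymmetricAlgebra k L)) :
    IsPoissonIdeal (poissonSpan X) := by
  intro a f hf
  simp only [poissonSpan, Submodule.mem_sInf] at hf ⊢
  exact fun I hI => hI.1 a f (hf I hI)

theorem subset_poissonSpan (X : Set (SymmetricAlgebra k L)) : X ⊆ poissonSpan X := by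
  intro f hf
  simp only [poissonSpan, SetLike.mem_coe, Submodule.mem_sInf]
  exact fun I hI => hI.2 hf

variable (k L) in
/-- The space of homogeneous elements of order `m` of the symmetric algebra: the span of the
products of `m` elements of `L`. -/
def homogeneousPart (m : ℕ) : Submodule k (SymmetricAlgebra k L) :=
  LinearMap.range (ι k L) ^ m

/-- The Poisson ideals generated by some (possibly infinite) set of quadratic elements. -/
def IsQuadraticallyGenerated (I : Ideal (SymmetricAlgebra k L)) : Prop :=
  ∃ X : Set (SymmetricAlgebra k L), X ⊆ homogeneousPart k L 2 ∧ I = poissonSpan X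

end SymmetricAlgebra

end

/-!
Let `xᵖ y^q` stand for `e (p + 1) * e (q + 1)`. Then `e (n + 1)` acts on quadratic elements through
the operator `xⁿ⁺¹ (x ∂/∂x - n) + yⁿ⁺¹ (y ∂/∂y - n)` on `k[x, y]`, and a Poisson ideal generated by
quadratic elements is determined by a subspace `M` of `k[x, y]` that is stable under these operators
and contains every antisymmetric polynomial.

Suppose that `M` contains a symmetric `f ≠ 0`. Modulo the antisymmetric polynomials the two summands
of the operators can be separated, and suitable combinations of them then produce a nonzero multiple
of `f` all of whose polynomial multiples lie in `M`. The largest ideal contained in `M` is thus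
nonzero; being stable under the vector fields `xⁿ⁺² ∂/∂x + yⁿ⁺² ∂/∂y`, it contains a power of
`x² y² (x - y)`. Hence an ascending chain of such subspaces can only grow along finitely many
infinitesimal neighbourhoods of the lines `x = 0`, `y = 0` and `x = y`. On each layer it becomes a
chain of submodules of a tensor density module over the Witt algebra, and these are all of finite
codimension from some point on unless they remain within a fixed finite-dimensional space.
-/

noncomputable section

namespace WittQuadratic

open Filter

section Chains

theorem eventuallyConst_of_inf_of_sup {ι α : Type*} [SemilatticeSup ι] [Nonempty ι] [Lattice α]
    [IsModularLattice α] {P : ι → α} (hP : Monotone P) {z : α}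
    (hinf : EventuallyConst (fun i => P i ⊓ z) atTop)
    (hsup : EventuallyConst (fun i => P i ⊔ z) atTop) : EventuallyConst P atTop := by
  obtain ⟨N, hN⟩ := eventuallyConst_atTop.1 (hinf.prodMk hsup)
  refine eventuallyConst_atTop.2 ⟨N, fun n hn => ?_⟩
  obtain ⟨hinf_eq, hsup_eq⟩ := Prod.ext_iff.1 (hN n hn)
  exact (eq_of_le_of_inf_le_of_sup_le (hP hn) hinf_eq.le hsup_eq.le).symm

variable {R V V' V'' : Type*} [Ring R] [AddCommGroup V] [Module R V] [AddCommGroup V']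
  [Module R V'] [AddCommGroup V''] [Module R V''] {P : ℕ → Submodule R V}

theorem eventuallyConst_of_comap_of_map (hP : Monotone P) {f : V' →ₗ[R] V} {g : V →ₗ[R] V''}
    (hfg : LinearMap.ker g ≤ LinearMap.range f)
    (hf : EventuallyConst (fun i => (P i).comap f) atTop)
    (hg : EventuallyConst (fun i => (P i).map g) atTop) : EventuallyConst P atTop := by
  refine eventuallyConst_of_inf_of_sup hP (z := LinearMap.ker g) ?_ ?_
  · convert hf.comp fun Q => Q.map f ⊓ LinearMap.ker g using 2 with i
    simp only [Function.comp_apply, Submodule.map_comap_eq]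
    rw [inf_right_comm, inf_eq_right.2 hfg, inf_comm]
  · simpa only [Function.comp_def, Submodule.comap_map_eq] using hg.comp (Submodule.comap g)

theorem eventuallyConst_of_sup (hP : Monotone P) {F : Submodule R V} [IsNoetherian R F]
    (hF : EventuallyConst (fun i => P i ⊔ F) atTop) : EventuallyConst P atTop := by
  refine eventuallyConst_of_comap_of_map hP (f := F.subtype) (g := F.mkQ) (by simp) ?_ ?_
  · exact eventuallyConst_of_isNoetherian
      ⟨fun i => (P i).comap F.subtype, fun _ _ h => Submodule.comap_mono (hP h)⟩
  · convert hF.comp (Submodule.map F.mkQ) using 2 with i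
    simp [Submodule.map_sup]

end Chains

section Densities

open Polynomial

variable {k : Type*} [Field k]

theorem sup_degreeLT_eq_top {P : Submodule k k[X]} {N : ℕ}
    (hP : ∀ d : ℕ, N ≤ d → ∃ p ∈ P, p.degree = d) : P ⊔ degreeLT k N = ⊤ := by
  refine eq_top_iff.2 fun q _ => ?_
  induction hd : q.degree using WellFoundedLT.induction generalizing q with
  | _ d ih =>
  by_cases hq : q ∈ degreeLT k N
  · exact Submodule.mem_sup_right hq
  have hq0 : q ≠ 0 := by
    rintro rfl
    exact hq (zero_mem _)
  obtain ⟨p, hp, hpq⟩ := hP q.natDegree (le_natDegree_of_coe_le_degree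
    (not_lt.1 (mt mem_degreeLT.2 hq)))
  have hp0 : p ≠ 0 := by
    rintro rfl
    exact WithBot.bot_ne_coe hpq
  set c := q.leadingCoeff / p.leadingCoeff
  have hc : c ≠ 0 := div_ne_zero (leadingCoeff_ne_zero.2 hq0) (leadingCoeff_ne_zero.2 hp0)
  have hlt : (q - c • p).degree < q.degree := by
    refine degree_sub_lt_left ?_ hq0 ?_
    · rw [degree_smul_of_smul_regular _ (IsSMulRegular.of_ne_zero hc),
        degree_eq_natDegree hq0, hpq]
    · rw [smul_eq_C_mul, leadingCoeff_mul, leadingCoeff_C,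
        div_mul_cancel₀ _ (leadingCoeff_ne_zero.2 hp0)]
  have hmem := add_mem (ih _ (hd ▸ hlt) (q - c • p) trivial rfl)
    (Submodule.mem_sup_left (P.smul_mem c hp))
  rwa [sub_add_cancel] at hmem

/-- The action of `e (n + 1)` on a module of tensor densities over the Witt algebra, with weight
and twist encoded by `α` and `β`: `tⁱ ↦ (i + α + n β) tⁱ⁺ⁿ⁺¹`. -/
def densityOp (α β : k) (n : ℕ) (p : k[X]) : k[X] :=
  X ^ (n + 1) * (X * derivative p + C (α + n * β) * p)

theorem degree_densityOp {α β : k} {n : ℕ} {p : k[X]} (hp : p ≠ 0)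
    (h : (p.natDegree + α) + n * β ≠ 0) :
    (densityOp α β n p).degree = (p.natDegree + (n + 1) : ℕ) := by
  set q := X * derivative p + C (α + n * β) * p with hq
  have hcoeff (i : ℕ) : q.coeff i = ((i + α) + n * β) * p.coeff i := by
    rw [hq, coeff_add, coeff_C_mul]
    cases i with
    | zero => simp
    | succ i =>
      rw [coeff_X_mul, coeff_derivative]
      push_cast
      ring
  have hlead : q.coeff p.natDegree ≠ 0 := by
    rw [hcoeff]
    exact mul_ne_zero h (leadingCoeff_ne_zero.2 hp)
  have hq0 : q ≠ 0 := by
    intro h0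
    exact hlead (by rw [h0, coeff_zero])
  have hdeg : q.natDegree = p.natDegree := by
    refine natDegree_eq_of_le_of_coeff_ne_zero (natDegree_le_iff_coeff_eq_zero.2 fun i hi => ?_)
      hlead
    rw [hcoeff, coeff_eq_zero_of_natDegree_lt hi, mul_zero]
  rw [densityOp, degree_mul, degree_X_pow, degree_eq_natDegree hq0, hdeg, ← Nat.cast_add, add_comm]

theorem eventually_add_natCast_mul_ne_zero [CharZero k] {a b : k} (h : a ≠ 0 ∨ b ≠ 0) :
    ∀ᶠ n : ℕ in atTop, a + n * b ≠ 0 := by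
  rcases eq_or_ne b 0 with rfl | hb
  · exact .of_forall fun n => by simpa using h
  rw [← Nat.cofinite_eq_atTop]
  refine Set.Subsingleton.finite fun m hm n hn => ?_
  have hmn : (m : k) * b = n * b := add_left_cancel ((not_not.1 hm).trans (not_not.1 hn).symm)
  exact_mod_cast mul_right_cancel₀ hb hmn

theorem eventuallyConst_of_densityOp_mem [CharZero k] {α β : k} {P : ℕ → Submodule k k[X]}
    (hP : Monotone P) (hmem : ∀ i n, ∀ p ∈ P i, densityOp α β n p ∈ P i) :
    EventuallyConst P atTop := by
  by_cases hbdd : ∃ d, ∀ i, P i ≤ degreeLT k d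
  · obtain ⟨d, hd⟩ := hbdd
    refine eventuallyConst_of_sup hP (F := degreeLT k d) ?_
    simpa only [sup_eq_right.2 (hd _)] using EventuallyConst.const _
  push Not at hbdd
  obtain ⟨d, hd⟩ := eventually_atTop.1
    (eventually_add_natCast_mul_ne_zero (a := α) (b := 1) (.inr one_ne_zero))
  obtain ⟨i, hi⟩ := hbdd d
  obtain ⟨p, hp, hpd⟩ := SetLike.not_le_iff_exists.1 hi
  have hp0 : p ≠ 0 := by
    rintro rfl
    exact hpd (zero_mem _)
  have hdp := hd p.natDegree (le_natDegree_of_coe_le_degree (not_lt.1 (mt mem_degreeLT.2 hpd)))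
  rw [mul_one, add_comm] at hdp
  obtain ⟨n₀, hn₀⟩ := eventually_atTop.1 (eventually_add_natCast_mul_ne_zero (b := β) (.inl hdp))
  have hdegrees : ∀ e : ℕ, p.natDegree + (n₀ + 1) ≤ e → ∃ q ∈ P i, q.degree = e := by
    intro e he
    obtain ⟨m, rfl⟩ := Nat.exists_eq_add_of_le he
    refine ⟨_, hmem i (n₀ + m) p hp, ?_⟩
    rw [degree_densityOp hp0 (hn₀ _ (Nat.le_add_right _ _))]
    congr 1
    omega
  refine eventuallyConst_of_sup hP (F := degreeLT k (p.natDegree + (n₀ + 1)))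
    (eventuallyConst_atTop.2 ⟨i, fun j hj => ?_⟩)
  rw [sup_degreeLT_eq_top hdegrees, eq_top_iff, ← sup_degreeLT_eq_top hdegrees]
  exact sup_le_sup_right (hP hj) _

end Densities

section WittOperators

open MvPolynomial

variable {σ R : Type*} [CommRing R]

/-- The vector field `∑ᵢ xᵢⁿ⁺² ∂ᵢ`, which represents `e (n + 1)` on the polynomial ring. -/
def wittField (n : ℕ) : Derivation R (MvPolynomial σ R) (MvPolynomial σ R) :=
  mkDerivation R fun i => X i ^ (n + 2)

@[simp]
theorem wittField_X (n : ℕ) (i : σ) : wittField n (X i : MvPolynomial σ R) = X i ^ (n + 2) :=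
  mkDerivation_X _ _ _

theorem wittField_apply [Fintype σ] (n : ℕ) (f : MvPolynomial σ R) :
    wittField n f = ∑ i, X i ^ (n + 2) * pderiv i f := by
  classical
  induction f using MvPolynomial.induction_on with
  | C a => simp [derivation_C]
  | add p q hp hq => simp only [map_add, hp, hq, mul_add, Finset.sum_add_distrib]
  | mul_X p i hp =>
    simp [Derivation.leibniz, hp, pderiv_X, Pi.single_apply, mul_add, Finset.sum_add_distrib,
      Finset.mul_sum, mul_left_comm, mul_comm]

/-- The vector field `wittField n` twisted by multiplication by `c n`. -/
def wittOp (c : ℕ → MvPolynomial σ R) (n : ℕ) : Module.End R (MvPolynomial σ R) :=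
  (wittField n).toLinearMap + LinearMap.mulLeft R (c n)

theorem wittOp_apply (c : ℕ → MvPolynomial σ R) (n : ℕ) (f : MvPolynomial σ R) :
    wittOp c n f = wittField n f + c n * f :=
  rfl

/-- A space of polynomials that is stable under the operators `wittOp c n`. -/
def WittStable (c : ℕ → MvPolynomial σ R) (M : Submodule R (MvPolynomial σ R)) : Prop :=
  ∀ n, ∀ f ∈ M, wittOp c n f ∈ M

theorem WittStable.comap_mulLeft {c d : ℕ → MvPolynomial σ R}
    {M : Submodule R (MvPolynomial σ R)} (hM : WittStable c M) {D : MvPolynomial σ R}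
    (hD : ∀ n, wittField n D = D * d n) :
    WittStable (c + d) (M.comap (LinearMap.mulLeft R D)) := by
  intro n f hf
  have h : wittOp c n (D * f) = D * wittOp (c + d) n f := by
    simp only [wittOp_apply, Derivation.leibniz, hD, smul_eq_mul, Pi.add_apply]
    ring
  rw [Submodule.mem_comap, LinearMap.mulLeft_apply, ← h]
  exact hM n _ hf

/-- The twist for which `wittField n` becomes the action of `e (n + 1)` on the tensor power of the
adjoint representation, the monomial `∏ xᵢ ^ pᵢ` standing for `⨂ e (pᵢ + 1)`. -/
def adjointTwist [Fintype σ] (n : ℕ) : MvPolynomial σ R :=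
  -(n : MvPolynomial σ R) * ∑ i, X i ^ (n + 1)

/-- The restriction of a polynomial to the line through the point `u`. -/
def restrictLine (u : σ → R) : MvPolynomial σ R →ₐ[R] Polynomial R :=
  aeval fun i => Polynomial.C (u i) * Polynomial.X

@[simp]
theorem restrictLine_X (u : σ → R) (i : σ) :
    restrictLine u (X i) = Polynomial.C (u i) * Polynomial.X :=
  aeval_X _ _

@[simp]
theorem restrictLine_C (u : σ → R) (a : R) : restrictLine u (C a) = Polynomial.C a :=
  aeval_C _ _

-- Idempotent coordinates are exactly what makes every `wittField n` tangent to the line.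
theorem restrictLine_wittField {u : σ → R} (hu : ∀ i, IsIdempotentElem (u i)) (n : ℕ)
    (f : MvPolynomial σ R) :
    restrictLine u (wittField n f) =
      Polynomial.X ^ (n + 2) * Polynomial.derivative (restrictLine u f) := by
  induction f using MvPolynomial.induction_on with
  | C a => simp [derivation_C]
  | add p q hp hq => simp only [map_add, hp, hq, mul_add]
  | mul_X p i hp =>
    have hi : (Polynomial.C (u i)) ^ (n + 2) = Polynomial.C (u i) := by
      rw [← map_pow, (hu i).pow_succ_eq]
    simp only [Derivation.leibniz, smul_eq_mul, map_add, map_mul, map_pow, wittField_X, hp,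
      restrictLine_X, mul_pow, hi, Polynomial.derivative_mul, Polynomial.derivative_C,
      Polynomial.derivative_X]
    ring

/-- The twists that restrict to tensor density modules on every line whose direction has idempotent
coordinates. -/
def IsDensityTwist (c : ℕ → MvPolynomial σ R) : Prop :=
  ∀ u : σ → R, (∀ i, IsIdempotentElem (u i)) →
    ∃ α β : R, ∀ n : ℕ, restrictLine u (c n) = Polynomial.C (α + n * β) * Polynomial.X ^ (n + 1)

theorem IsDensityTwist.add {c d : ℕ → MvPolynomial σ R} (hc : IsDensityTwist c)
    (hd : IsDensityTwist d) : IsDensityTwist (c + d) := by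
  intro u hu
  obtain ⟨α, β, hα⟩ := hc u hu
  obtain ⟨α', β', hα'⟩ := hd u hu
  refine ⟨α + α', β + β', fun n => ?_⟩
  rw [Pi.add_apply, map_add, hα, hα', ← add_mul, ← map_add]
  congr 2
  ring

theorem isDensityTwist_adjointTwist [Fintype σ] :
    IsDensityTwist (adjointTwist : ℕ → MvPolynomial σ R) := by
  intro u hu
  refine ⟨0, -∑ i, u i, fun n => ?_⟩
  simp only [adjointTwist, map_mul, map_neg, map_natCast, map_sum, map_pow, restrictLine_X,
    mul_pow, ← Polynomial.C_pow, (hu _).pow_succ_eq, ← Finset.sum_mul, zero_add]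
  ring

end WittOperators

section Lines

open MvPolynomial

section CommRing

variable {R : Type*} [CommRing R]

/-- The linear form that vanishes on the line through `u`. -/
def lineForm (u : Fin 2 → R) : MvPolynomial (Fin 2) R := C (u 1) * X 0 - C (u 0) * X 1

/-- The quotient of `wittField n (lineForm u)` by `lineForm u`. -/
def lineCofactor (u : Fin 2 → R) (n : ℕ) : MvPolynomial (Fin 2) R :=
  ∑ i ∈ Finset.range (n + 2), (C (u 1) * X 0) ^ i * (C (u 0) * X 1) ^ (n + 1 - i)

theorem wittField_lineForm {u : Fin 2 → R} (hu : ∀ i, IsIdempotentElem (u i)) (n : ℕ) :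
    wittField n (lineForm u) = lineForm u * lineCofactor u n := by
  have h := (Commute.all (C (u 1) * X 0 : MvPolynomial (Fin 2) R) (C (u 0) * X 1)).geom_sum₂_mul
    (n + 2)
  rw [lineForm, lineCofactor, mul_comm (_ - _)]
  refine Eq.trans ?_ h.symm
  simp only [mul_pow, ← C_pow, (hu _).pow_succ_eq, map_sub, Derivation.leibniz, derivation_C,
    wittField_X, smul_eq_mul, add_zero, mul_zero]

theorem sum_pow_mul_pow_of_isIdempotentElem {a b : R} (ha : IsIdempotentElem a)
    (hb : IsIdempotentElem b) (n : ℕ) :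
    ∑ i ∈ Finset.range (n + 2), a ^ i * b ^ (n + 1 - i) = a + b + n * (a * b) := by
  have hmid : ∀ i ∈ Finset.range n, a ^ (i + 1) * b ^ (n + 1 - (i + 1)) = a * b := by
    intro i hi
    rw [ha.pow_succ_eq, hb.pow_eq (by have := Finset.mem_range.1 hi; omega)]
  rw [Finset.sum_range_succ, Finset.sum_range_succ', Finset.sum_congr rfl hmid]
  simp only [Finset.sum_const, Finset.card_range, nsmul_eq_mul, pow_zero, Nat.sub_zero,
    Nat.sub_self, ha.pow_succ_eq, hb.pow_succ_eq]
  ring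

theorem isDensityTwist_lineCofactor {u : Fin 2 → R} (hu : ∀ i, IsIdempotentElem (u i)) :
    IsDensityTwist (lineCofactor u) := by
  intro w hw
  refine ⟨u 1 * w 0 + u 0 * w 1, u 1 * w 0 * (u 0 * w 1), fun n => ?_⟩
  rw [← sum_pow_mul_pow_of_isIdempotentElem ((hu 1).mul (hw 0)) ((hu 0).mul (hw 1)) n, map_sum,
    Finset.sum_mul, lineCofactor, map_sum]
  refine Finset.sum_congr rfl fun i hi => ?_
  have hX : (Polynomial.X : Polynomial R) ^ (n + 1) =
      Polynomial.X ^ i * Polynomial.X ^ (n + 1 - i) := by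
    rw [← pow_add, Nat.add_sub_cancel' (by have := Finset.mem_range.1 hi; omega)]
  simp only [map_mul, map_pow, restrictLine_C, restrictLine_X, hX]
  ring

theorem lineForm_dvd {u : Fin 2 → R} {j : Fin 2} (hj : u j = 1) {f : MvPolynomial (Fin 2) R}
    (hf : restrictLine u f = 0) : lineForm u ∣ f := by
  let π := Ideal.Quotient.mkₐ R (Ideal.span {lineForm u})
  have hX (i : Fin 2) : π (X i) = π (C (u i) * X j) := by
    have hneg : (C (u 1) * X 0 - X 1 : MvPolynomial (Fin 2) R) ∣ X 1 - C (u 1) * X 0 :=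
      dvd_sub_comm.1 dvd_rfl
    refine Ideal.Quotient.eq.2 (Ideal.mem_span_singleton.2 ?_)
    fin_cases i <;> fin_cases j <;> simp_all [lineForm]
  have hπ : π = (π.comp (Polynomial.aeval (X j))).comp (restrictLine u) := by
    ext i
    simpa [← algebraMap_eq] using hX i
  refine Ideal.mem_span_singleton.1 (Ideal.Quotient.eq_zero_iff_mem.1 ?_)
  change π f = 0
  rw [hπ, AlgHom.comp_apply, hf, map_zero]

end CommRing

variable {k : Type*} [Field k] [CharZero k] {M : ℕ → Submodule k (MvPolynomial (Fin 2) k)}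
  {c : ℕ → MvPolynomial (Fin 2) k}

theorem eventuallyConst_of_comap_lineForm (hmono : Monotone M) (hM : ∀ m, WittStable c (M m))
    (hc : IsDensityTwist c) {u : Fin 2 → k} (hu : ∀ i, IsIdempotentElem (u i)) {j : Fin 2}
    (hj : u j = 1)
    (h : EventuallyConst (fun m => (M m).comap (LinearMap.mulLeft k (lineForm u))) atTop) :
    EventuallyConst M atTop := by
  refine eventuallyConst_of_comap_of_map hmono (g := (restrictLine u).toLinearMap)
    (fun f hf => ?_) h ?_
  · obtain ⟨g, rfl⟩ := lineForm_dvd hj hf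
    exact ⟨g, rfl⟩
  obtain ⟨α, β, hαβ⟩ := hc u hu
  refine eventuallyConst_of_densityOp_mem (α := α) (β := β)
    (fun _ _ hle => Submodule.map_mono (hmono hle)) ?_
  rintro m n - ⟨f, hf, rfl⟩
  refine ⟨_, hM m n f hf, ?_⟩
  rw [AlgHom.toLinearMap_apply, wittOp_apply, map_add, map_mul, restrictLine_wittField hu, hαβ,
    densityOp, AlgHom.toLinearMap_apply]
  ring

variable (k) in
/-- The linear forms that cut out the lines with idempotent direction; up to sign these are `x`,
`y` and `x - y`. -/
def lineForms : Set (MvPolynomial (Fin 2) k) :=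
  {ℓ | ∃ u : Fin 2 → k, (∀ i, IsIdempotentElem (u i)) ∧ (∃ j, u j = 1) ∧ lineForm u = ℓ}

theorem eventuallyConst_of_comap_mulLeft {D : MvPolynomial (Fin 2) k}
    (hD : D ∈ Submonoid.closure (lineForms k)) (hmono : Monotone M)
    (hM : ∀ m, WittStable c (M m)) (hc : IsDensityTwist c)
    (h : EventuallyConst (fun m => (M m).comap (LinearMap.mulLeft k D)) atTop) :
    EventuallyConst M atTop := by
  induction hD using Submonoid.closure_induction_left generalizing M c with
  | one => simpa using h
  | mul_left ℓ hℓ D _ ih =>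
    obtain ⟨u, hu, ⟨j, hj⟩, rfl⟩ := hℓ
    refine eventuallyConst_of_comap_lineForm hmono hM hc hu hj
      (ih (fun _ _ hle => Submodule.comap_mono (hmono hle))
        (fun m => (hM m).comap_mulLeft (wittField_lineForm hu))
        (hc.add (isDensityTwist_lineCofactor hu)) ?_)
    simpa only [LinearMap.mulLeft_mul, Submodule.comap_comp] using h

end Lines

section Euler

open MvPolynomial

variable {σ R : Type*} [CommRing R]

/-- The Euler derivation `xᵢ ∂ᵢ`. -/
def euler (i : σ) : Derivation R (MvPolynomial σ R) (MvPolynomial σ R) :=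
  (X i : MvPolynomial σ R) • pderiv i

theorem euler_apply (i : σ) (f : MvPolynomial σ R) : euler i f = X i * pderiv i f :=
  rfl

theorem euler_X [DecidableEq σ] (i j : σ) :
    euler i (X j : MvPolynomial σ R) = if i = j then X j else 0 := by
  rcases eq_or_ne i j with rfl | hij
  · simp [euler_apply]
  · simp [euler_apply, hij, pderiv_X_of_ne hij.symm]

theorem euler_X_pow [DecidableEq σ] (i j : σ) (n : ℕ) :
    euler i (X j ^ n : MvPolynomial σ R) =
      if i = j then (n : MvPolynomial σ R) * X j ^ n else 0 := by
  induction n with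
  | zero => simp
  | succ n ih =>
    rw [pow_succ, Derivation.leibniz, ih, euler_X]
    split_ifs <;> simp
    ring

theorem euler_ofNat (i : σ) (n : ℕ) [n.AtLeastTwo] :
    euler i (ofNat(n) : MvPolynomial σ R) = 0 :=
  (euler i).map_natCast n

theorem euler_comm (i j : σ) (f : MvPolynomial σ R) :
    euler i (euler j f) = euler j (euler i f) := by
  classical
  have h : ⁅euler i, euler j⁆ = (0 : Derivation R (MvPolynomial σ R) (MvPolynomial σ R)) :=
    derivation_ext fun l => by
      rw [Derivation.commutator_apply]
      by_cases hi : i = l <;> by_cases hj : j = l <;> simp [euler_X, hi, hj]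
  exact sub_eq_zero.1 congr($h f)

theorem wittOp_adjointTwist_apply [Fintype σ] (n : ℕ) (f : MvPolynomial σ R) :
    wittOp adjointTwist n f = ∑ i, X i ^ (n + 1) * (euler i f - (n : MvPolynomial σ R) * f) := by
  simp only [wittOp_apply, wittField_apply, adjointTwist, euler_apply, mul_assoc,
    Finset.sum_mul, Finset.mul_sum, ← Finset.sum_add_distrib]
  exact Finset.sum_congr rfl fun i _ => by ring

/-- Hirota's bilinear derivative `c · xᵢ∂ᵢ f - xᵢ∂ᵢ c · f`, as a function of `c`. -/
def hirota (i : σ) (f : MvPolynomial σ R) : Module.End R (MvPolynomial σ R) :=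
  LinearMap.mulRight R (euler i f) - LinearMap.mulRight R f ∘ₗ (euler i).toLinearMap

theorem hirota_apply (i : σ) (f c : MvPolynomial σ R) :
    hirota i f c = c * euler i f - euler i c * f :=
  rfl

theorem hirota_mul {i : σ} {g : MvPolynomial σ R} (hg : euler i g = 0) (f c : MvPolynomial σ R) :
    hirota i f (g * c) = g * hirota i f c := by
  rw [hirota_apply, hirota_apply, Derivation.leibniz, hg, smul_zero, add_zero, smul_eq_mul]
  ring

/-- Hirota's second bilinear derivative; it sends a monomial `c = ∏ xᵢ ^ pᵢ` to
`c · (xᵢ∂ᵢ - pᵢ) (xⱼ∂ⱼ - pⱼ) f`. -/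
def hirota₂ (i j : σ) (f : MvPolynomial σ R) : Module.End R (MvPolynomial σ R) :=
  hirota i (euler j f) - hirota i f ∘ₗ (euler j).toLinearMap

theorem hirota₂_apply (i j : σ) (f c : MvPolynomial σ R) :
    hirota₂ i j f c = hirota i (euler j f) c - hirota i f (euler j c) :=
  rfl

end Euler

section Elimination

open MvPolynomial

section CommRing

variable {R : Type*} [CommRing R]

theorem eq_top_of_X_pow_mul_X_pow_mem {N : Submodule R (MvPolynomial (Fin 2) R)}
    (h : ∀ i j : ℕ, X 0 ^ i * X 1 ^ j ∈ N) : N = ⊤ := by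
  refine eq_top_iff.2 fun f _ => ?_
  induction f using MvPolynomial.induction_on' with
  | monomial u a =>
    rw [monomial_eq, Finsupp.prod_fintype _ _ fun _ => pow_zero _, Fin.prod_univ_two,
      ← smul_eq_C_mul]
    exact N.smul_mem a (h _ _)
  | add p q hp hq => exact N.add_mem (hp trivial) (hq trivial)

/-- The summand of `wittOp adjointTwist i f` that belongs to the variable `X 0`. -/
def leftPart (f : MvPolynomial (Fin 2) R) (i : ℕ) : MvPolynomial (Fin 2) R :=
  X 0 ^ (i + 1) * (euler 0 f - (i : MvPolynomial (Fin 2) R) * f)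

variable (f : MvPolynomial (Fin 2) R)

theorem wittOp_leftPart (i j : ℕ) :
    wittOp adjointTwist j (leftPart f i) =
      X 0 * X 1 * hirota₂ 0 1 f (X 0 ^ i * X 1 ^ j) +
        X 0 ^ (i + j + 2) * (euler 0 (euler 0 f) + (1 - j : MvPolynomial (Fin 2) R) * euler 0 f -
          (i * (i + 1 - j) : MvPolynomial (Fin 2) R) * f) := by
  simp only [leftPart, Fin.isValue, wittOp_adjointTwist_apply, Fin.sum_univ_two, hirota₂_apply,
    hirota_apply, Derivation.leibniz, Derivation.map_natCast, map_sub, euler_X_pow,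
    euler_comm (1 : Fin 2) 0, smul_eq_mul, mul_zero, add_zero, zero_add, mul_ite, ↓reduceIte,
    one_ne_zero, zero_ne_one]
  push_cast
  ring

theorem mul_hirota₂_X_pow_mul_X_pow (i j : ℕ) :
    X 0 * X 1 * hirota₂ 0 1 f ((X 0 - X 1) ^ 3 * (X 0 ^ i * X 1 ^ j)) =
      wittOp adjointTwist j (leftPart f (i + 3)) -
      3 • wittOp adjointTwist (j + 1) (leftPart f (i + 2)) +
      3 • wittOp adjointTwist (j + 2) (leftPart f (i + 1)) -
      wittOp adjointTwist (j + 3) (leftPart f i) := by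
  have hcube : ((X 0 : MvPolynomial (Fin 2) R) - X 1) ^ 3 * (X 0 ^ i * X 1 ^ j) =
      X 0 ^ (i + 3) * X 1 ^ j - (3 : R) • (X 0 ^ (i + 2) * X 1 ^ (j + 1)) +
        (3 : R) • (X 0 ^ (i + 1) * X 1 ^ (j + 2)) - X 0 ^ i * X 1 ^ (j + 3) := by
    simp only [smul_eq_C_mul, map_ofNat]
    ring
  simp only [hcube, map_sub, map_add, map_smul, wittOp_leftPart]
  simp only [smul_eq_C_mul, map_ofNat, nsmul_eq_mul]
  push_cast
  ring

-- `a n` is the coefficient of `zⁿ` in `(z - x)² (z - y)³`: at `z = x` only the part of second order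
-- in `z` and `x` survives, at `z = y` nothing does.
theorem exists_sum_wittOp_hirota₂ : ∃ a : ℕ → MvPolynomial (Fin 2) R, ∀ f v,
    ∑ n ∈ Finset.range 6, wittOp adjointTwist n (X 0 * X 1 * hirota₂ 0 1 f (a n * v)) =
      (-4 : R) • (X 0 ^ 4 * X 1 * hirota 1 f ((X 0 - X 1) ^ 3 * v)) := by
  let a : ℕ → MvPolynomial (Fin 2) R
    | 0 => -(X 0 ^ 2 * X 1 ^ 3)
    | 1 => 3 * X 0 ^ 2 * X 1 ^ 2 + 2 * X 0 * X 1 ^ 3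
    | 2 => -(3 * X 0 ^ 2 * X 1 + 6 * X 0 * X 1 ^ 2 + X 1 ^ 3)
    | 3 => X 0 ^ 2 + 6 * X 0 * X 1 + 3 * X 1 ^ 2
    | 4 => -(2 * X 0 + 3 * X 1)
    | _ => 1
  refine ⟨a, fun f v => ?_⟩
  simp only [a, Fin.isValue, Finset.sum_range_succ, Finset.sum_range_zero,
    wittOp_adjointTwist_apply, Fin.sum_univ_two, hirota₂_apply, hirota_apply, map_add, map_sub,
    map_neg, map_zero, Derivation.leibniz, Derivation.leibniz_pow, Derivation.map_one_eq_zero,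
    Derivation.map_natCast, euler_X, euler_ofNat, euler_comm (1 : Fin 2) 0, smul_eq_mul,
    nsmul_eq_mul, smul_eq_C_mul, map_ofNat, mul_zero, add_zero, zero_add, ↓reduceIte,
    one_ne_zero, zero_ne_one]
  push_cast
  ring

-- Here `a n` is the coefficient of `zⁿ` in `(z - x)² (z - y)²`.
theorem exists_sum_wittOp_hirota : ∃ a : ℕ → MvPolynomial (Fin 2) R, ∀ f v,
    ∑ n ∈ Finset.range 5, wittOp adjointTwist n (X 0 * X 1 * hirota 1 f (a n * v)) =
      (-4 : R) • (X 0 * X 1 ^ 4 * (X 0 - X 1) ^ 2 * v * f) := by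
  let a : ℕ → MvPolynomial (Fin 2) R
    | 0 => X 0 ^ 2 * X 1 ^ 2
    | 1 => -(2 * X 0 ^ 2 * X 1 + 2 * X 0 * X 1 ^ 2)
    | 2 => X 0 ^ 2 + 4 * X 0 * X 1 + X 1 ^ 2
    | 3 => -(2 * X 0 + 2 * X 1)
    | _ => 1
  refine ⟨a, fun f v => ?_⟩
  simp only [a, Fin.isValue, Finset.sum_range_succ, Finset.sum_range_zero,
    wittOp_adjointTwist_apply, Fin.sum_univ_two, hirota_apply, map_add, map_sub, map_neg,
    map_zero, Derivation.leibniz, Derivation.leibniz_pow, Derivation.map_one_eq_zero,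
    Derivation.map_natCast, euler_X, euler_ofNat, smul_eq_mul, nsmul_eq_mul,
    smul_eq_C_mul, map_ofNat, mul_zero, add_zero, zero_add, ↓reduceIte, one_ne_zero, zero_ne_one]
  push_cast
  ring

/-- The automorphism that exchanges the two variables. -/
def swapVars : MvPolynomial (Fin 2) R →ₐ[R] MvPolynomial (Fin 2) R :=
  rename (Equiv.swap 0 1)

theorem swapVars_X (i : Fin 2) :
    swapVars (X i : MvPolynomial (Fin 2) R) = X (Equiv.swap 0 1 i) :=
  rename_X _ _

theorem swapVars_swapVars (f : MvPolynomial (Fin 2) R) : swapVars (swapVars f) = f := by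
  rw [swapVars, rename_rename, ← Equiv.coe_trans, Equiv.swap_swap, Equiv.coe_refl, rename_id_apply]

theorem swapVars_euler (i : Fin 2) (f : MvPolynomial (Fin 2) R) :
    swapVars (euler i f) = euler (Equiv.swap 0 1 i) (swapVars f) := by
  rw [euler_apply, euler_apply, map_mul, swapVars_X, swapVars,
    pderiv_rename (Equiv.injective _)]

theorem wittOp_adjointTwist_eq_add_swapVars {f : MvPolynomial (Fin 2) R} (hf : swapVars f = f)
    (n : ℕ) : wittOp adjointTwist n f = leftPart f n + swapVars (leftPart f n) := by
  rw [wittOp_adjointTwist_apply, Fin.sum_univ_two, leftPart, map_mul, map_pow, swapVars_X, map_sub,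
    swapVars_euler, map_mul, map_natCast, hf, Equiv.swap_apply_left]

theorem mul_hirota₂_mem {M : Submodule R (MvPolynomial (Fin 2) R)}
    {f : MvPolynomial (Fin 2) R} (hM : WittStable adjointTwist M) (hf : ∀ n, leftPart f n ∈ M)
    (v : MvPolynomial (Fin 2) R) :
    X 0 * X 1 * hirota₂ 0 1 f ((X 0 - X 1) ^ 3 * v) ∈ M := by
  have htop : M.comap (LinearMap.mulLeft R (X 0 * X 1) ∘ₗ hirota₂ 0 1 f ∘ₗ
      LinearMap.mulLeft R ((X 0 - X 1) ^ 3)) = ⊤ := by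
    refine eq_top_of_X_pow_mul_X_pow_mem fun i j => ?_
    change X 0 * X 1 * hirota₂ 0 1 f ((X 0 - X 1) ^ 3 * (X 0 ^ i * X 1 ^ j)) ∈ M
    rw [mul_hirota₂_X_pow_mul_X_pow]
    exact M.sub_mem (M.add_mem (M.sub_mem (hM _ _ (hf _)) (M.nsmul_mem (hM _ _ (hf _)) 3))
      (M.nsmul_mem (hM _ _ (hf _)) 3)) (hM _ _ (hf _))
  exact Submodule.eq_top_iff'.1 htop v

end CommRing

variable {k : Type*} [Field k] [CharZero k] {M : Submodule k (MvPolynomial (Fin 2) k)}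
  {f : MvPolynomial (Fin 2) k}

theorem leftPart_mem (hM : WittStable adjointTwist M) (hswap : ∀ g, g - swapVars g ∈ M)
    (hf : f ∈ M) (hsymm : swapVars f = f) (n : ℕ) : leftPart f n ∈ M := by
  have h := M.add_mem (hM n f hf) (hswap (leftPart f n))
  rw [wittOp_adjointTwist_eq_add_swapVars hsymm, add_add_sub_cancel, ← two_smul k] at h
  exact (M.smul_mem_iff two_ne_zero).1 h

theorem mul_hirota_mem_of_mul_hirota₂_mem (hM : WittStable adjointTwist M)
    {w : MvPolynomial (Fin 2) k} (h : ∀ v, X 0 * X 1 * hirota₂ 0 1 f (w * v) ∈ M)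
    (v : MvPolynomial (Fin 2) k) :
    X 0 * X 1 * hirota 1 f (X 0 ^ 3 * (X 0 - X 1) ^ 3 * w * v) ∈ M := by
  obtain ⟨a, ha⟩ := exists_sum_wittOp_hirota₂ (R := k)
  have hpull : X 0 * X 1 * hirota 1 f (X 0 ^ 3 * (X 0 - X 1) ^ 3 * w * v) =
      X 0 ^ 4 * X 1 * hirota 1 f ((X 0 - X 1) ^ 3 * (w * v)) := by
    have hX : euler 1 (X 0 ^ 3 : MvPolynomial (Fin 2) k) = 0 := by
      rw [euler_X_pow, if_neg one_ne_zero]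
    rw [mul_assoc _ w v, mul_assoc, mul_assoc, hirota_mul hX]
    ring
  rw [hpull]
  refine (M.smul_mem_iff (show (-4 : k) ≠ 0 by norm_num)).1 ?_
  rw [← ha]
  exact M.sum_mem fun n _ => hM n _ (mul_left_comm w (a n) v ▸ h (a n * v))

theorem mul_mem_of_mul_hirota_mem (hM : WittStable adjointTwist M) {w : MvPolynomial (Fin 2) k}
    (h : ∀ v, X 0 * X 1 * hirota 1 f (w * v) ∈ M) (v : MvPolynomial (Fin 2) k) :
    X 0 * X 1 ^ 4 * (X 0 - X 1) ^ 2 * (w * v) * f ∈ M := by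
  obtain ⟨a, ha⟩ := exists_sum_wittOp_hirota (R := k)
  refine (M.smul_mem_iff (show (-4 : k) ≠ 0 by norm_num)).1 ?_
  rw [← ha]
  exact M.sum_mem fun n _ => hM n _ (mul_left_comm w (a n) v ▸ h (a n * v))

end Elimination

section Core

/-- The largest ideal contained in a subspace of a commutative algebra. -/
def idealCore {R A : Type*} [CommRing R] [CommRing A] [Algebra R A] (M : Submodule R A) :
    Ideal A where
  carrier := {f | ∀ g, f * g ∈ M}
  add_mem' ha hb g := by
    rw [add_mul]
    exact M.add_mem (ha g) (hb g)
  zero_mem' g := by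
    rw [zero_mul]
    exact M.zero_mem
  smul_mem' a f hf g := by
    rw [smul_eq_mul, mul_comm a, mul_assoc]
    exact hf _

open MvPolynomial

section CommRing

variable {R : Type*} [CommRing R]

theorem wittField_mem_idealCore {σ : Type*} {c : ℕ → MvPolynomial σ R}
    {M : Submodule R (MvPolynomial σ R)} (hM : WittStable c M) (n : ℕ) {f : MvPolynomial σ R}
    (hf : f ∈ idealCore M) : wittField n f ∈ idealCore M := by
  intro g
  have h : wittField n f * g = wittOp c n (f * g) - f * wittOp c n g := by
    simp only [wittOp_apply, Derivation.leibniz, smul_eq_mul]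
    ring
  rw [h]
  exact M.sub_mem (hM n _ (hf g)) (hf _)

theorem mul_pderiv_mem_of_wittField_mem {J : Ideal (MvPolynomial (Fin 2) R)}
    (hJ : ∀ n, ∀ f ∈ J, wittField n f ∈ J) {f : MvPolynomial (Fin 2) R} (hf : f ∈ J)
    (i : Fin 2) : X 0 ^ 2 * X 1 ^ 2 * (X 0 - X 1) * pderiv i f ∈ J := by
  have h₀ := hJ 0 f hf
  have h₁ := hJ 1 f hf
  rw [wittField_apply, Fin.sum_univ_two] at h₀ h₁
  fin_cases i
  · convert J.mul_mem_left (X 1 ^ 2) (J.sub_mem h₁ (J.mul_mem_left (X 1) h₀)) using 1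
    simp only [Fin.zero_eta]
    ring
  · convert J.mul_mem_left (X 0 ^ 2) (J.sub_mem (J.mul_mem_left (X 0) h₀) h₁) using 1
    simp only [Fin.mk_one]
    ring

end CommRing

section Derivatives

variable {σ R : Type*} [CommRing R]

theorem exists_pderiv_ne_zero [IsDomain R] [CharZero R] {f : MvPolynomial σ R}
    (hf : f.totalDegree ≠ 0) : ∃ i, pderiv i f ≠ 0 := by
  classical
  obtain ⟨m, hm, i, hi⟩ : ∃ m ∈ f.support, ∃ i, m i ≠ 0 := by
    contrapose! hf
    exact (totalDegree_eq_zero_iff _ _).2 hf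
  have hle : Finsupp.single i 1 ≤ m := Finsupp.single_le_iff.2 (Nat.one_le_iff_ne_zero.2 hi)
  refine ⟨i, fun h => ?_⟩
  have hcoeff := coeff_pderiv (i := i) f (m - Finsupp.single i 1)
  rw [h, coeff_zero, tsub_add_cancel_of_le hle] at hcoeff
  exact mul_ne_zero (mem_support_iff.1 hm) (Nat.cast_add_one_ne_zero _) hcoeff.symm

theorem totalDegree_pderiv_lt {f : MvPolynomial σ R} (hf : f.totalDegree ≠ 0) (i : σ) :
    (pderiv i f).totalDegree < f.totalDegree := by
  classical
  refine (Finset.sup_lt_iff (Nat.pos_of_ne_zero hf)).2 fun m hm => ?_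
  rw [mem_support_iff, coeff_pderiv] at hm
  have h := le_totalDegree (mem_support_iff.2 (left_ne_zero_of_mul hm))
  rw [Finsupp.sum_add_index' (by simp) (by simp), Finsupp.sum_single_index rfl] at h
  exact h

theorem mem_radical_of_mul_pderiv_mem {k : Type*} [Field k] [CharZero k]
    {J : Ideal (MvPolynomial σ k)} {d : MvPolynomial σ k}
    (hJ : ∀ f ∈ J, ∀ i, d * pderiv i f ∈ J) (hJ0 : J ≠ ⊥) : d ∈ J.radical := by
  suffices h : ∀ f n, f ≠ 0 → d ^ n * f ∈ J → d ∈ J.radical by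
    obtain ⟨f, hf, hf0⟩ := J.ne_bot_iff.1 hJ0
    exact h f 0 hf0 (by simpa using hf)
  intro f n hf hfJ
  induction hdeg : f.totalDegree using Nat.strong_induction_on generalizing f n with
  | _ D ih =>
  by_cases h0 : f.totalDegree = 0
  · rw [totalDegree_eq_zero_iff_eq_C] at h0
    have hunit : IsUnit f := by
      rw [h0, isUnit_map_iff, isUnit_iff_ne_zero]
      exact fun h => hf (by rw [h0, h, map_zero])
    exact ⟨n, (J.mul_unit_mem_iff_mem hunit).1 hfJ⟩
  · obtain ⟨i, hi⟩ := exists_pderiv_ne_zero h0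
    refine ih _ (hdeg ▸ totalDegree_pderiv_lt h0 i) _ (n + 1) hi ?_ rfl
    have h := J.sub_mem (hJ _ hfJ i) (J.mul_mem_left (n • pderiv i d) hfJ)
    rcases n with _ | n
    · simpa using h
    · convert h using 1
      rw [pderiv_mul, pderiv_pow, nsmul_eq_mul, Nat.add_sub_cancel]
      ring

end Derivatives

variable {k : Type*} [Field k]

theorem sq_mul_sq_mul_sub_mem_closure_lineForms :
    (X 0 ^ 2 * X 1 ^ 2 * (X 0 - X 1) : MvPolynomial (Fin 2) k) ∈
      Submonoid.closure (lineForms k) := by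
  have hX₀ : X 0 ∈ lineForms k :=
    ⟨![0, 1], by simp [Fin.forall_fin_two, IsIdempotentElem], ⟨1, rfl⟩, by simp [lineForm]⟩
  have hX₁ : -X 1 ∈ lineForms k :=
    ⟨![1, 0], by simp [Fin.forall_fin_two, IsIdempotentElem], ⟨0, rfl⟩, by simp [lineForm]⟩
  have hsub : X 0 - X 1 ∈ lineForms k :=
    ⟨1, fun _ => IsIdempotentElem.one, ⟨0, rfl⟩, by simp [lineForm]⟩
  rw [← neg_sq (X 1 : MvPolynomial (Fin 2) k)]
  exact mul_mem (mul_mem (pow_mem (Submonoid.subset_closure hX₀) 2)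
    (pow_mem (Submonoid.subset_closure hX₁) 2)) (Submonoid.subset_closure hsub)

variable [CharZero k]

theorem mem_radical_idealCore {M : Submodule k (MvPolynomial (Fin 2) k)}
    (hM : WittStable adjointTwist M) (hswap : ∀ g, g - swapVars g ∈ M)
    {f : MvPolynomial (Fin 2) k} (hf : f ∈ M) (hsymm : swapVars f = f) (hf0 : f ≠ 0) :
    X 0 ^ 2 * X 1 ^ 2 * (X 0 - X 1) ∈ (idealCore M).radical := by
  refine mem_radical_of_mul_pderiv_mem (fun g hg i => mul_pderiv_mem_of_wittField_mem
    (fun n _ => wittField_mem_idealCore hM n) hg i) ?_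
  have hmem : X 0 * X 1 ^ 4 * (X 0 - X 1) ^ 2 * (X 0 ^ 3 * (X 0 - X 1) ^ 3 * (X 0 - X 1) ^ 3) * f ∈
      idealCore M := by
    intro v
    have h := mul_mem_of_mul_hirota_mem hM
      (mul_hirota_mem_of_mul_hirota₂_mem hM (mul_hirota₂_mem hM (leftPart_mem hM hswap hf hsymm))) v
    rwa [← mul_assoc _ _ v, mul_right_comm _ v f] at h
  have hne : (X 0 - X 1 : MvPolynomial (Fin 2) k) ≠ 0 :=
    sub_ne_zero.2 fun h => zero_ne_one (X_injective h)
  refine (Submodule.ne_bot_iff _).2 ⟨_, hmem, ?_⟩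
  simp [hne, X_ne_zero, hf0]

theorem eventuallyConst_of_mem_idealCore {M : ℕ → Submodule k (MvPolynomial (Fin 2) k)}
    {c : ℕ → MvPolynomial (Fin 2) k} (hmono : Monotone M) (hM : ∀ m, WittStable c (M m))
    (hc : IsDensityTwist c) {D : MvPolynomial (Fin 2) k}
    (hD : D ∈ Submonoid.closure (lineForms k)) {m : ℕ} (hDm : D ∈ idealCore (M m)) :
    EventuallyConst M atTop := by
  refine eventuallyConst_of_comap_mulLeft hD hmono hM hc
    (eventuallyConst_atTop.2 ⟨m, fun n hn => ?_⟩)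
  have htop (n : ℕ) (hn : m ≤ n) : (M n).comap (LinearMap.mulLeft k D) = ⊤ :=
    Submodule.eq_top_iff'.2 fun g => hmono hn (hDm g)
  rw [htop n hn, htop m le_rfl]

theorem eventuallyConst_of_wittStable {M : ℕ → Submodule k (MvPolynomial (Fin 2) k)}
    (hmono : Monotone M) (hM : ∀ m, WittStable adjointTwist (M m))
    (hswap : ∀ m g, g - swapVars g ∈ M m) : EventuallyConst M atTop := by
  by_cases hsymm : ∃ m, ∃ f ∈ M m, f + swapVars f ≠ 0
  · obtain ⟨m, f, hf, hf0⟩ := hsymm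
    have hmem : f + swapVars f ∈ M m := by
      convert (M m).sub_mem ((M m).smul_mem (2 : k) hf) (hswap m f) using 1
      module
    obtain ⟨N, hN⟩ := mem_radical_idealCore (hM m) (hswap m) hmem
      (by rw [map_add, swapVars_swapVars, add_comm]) hf0
    exact eventuallyConst_of_mem_idealCore hmono hM isDensityTwist_adjointTwist
      (pow_mem sq_mul_sq_mul_sub_mem_closure_lineForms N) hN
  · push Not at hsymm
    refine eventuallyConst_atTop.2 ⟨0, fun n hn => le_antisymm (fun f hf => ?_) (hmono hn)⟩
    have h : (2 : k) • f = f - swapVars f := by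
      rw [two_smul, ← neg_eq_of_add_eq_zero_right (hsymm n f hf), sub_neg_eq_add]
    exact ((M 0).smul_mem_iff two_ne_zero).1 (h ▸ hswap 0 f)

end Core

section Quadratic

open MvPolynomial SymmetricAlgebra

variable {k : Type*} [Field k]

/-- The surjection of `k[x, y]` onto `S²(W₊)` that sends `xᵖ y^q` to `e (p + 1) * e (q + 1)`. -/
def toQuadratic : MvPolynomial (Fin 2) k →ₗ[k] SymmetricAlgebra k (PositiveWitt k) :=
  (basisMonomials (Fin 2) k).constr k fun u =>
    ι k _ (PositiveWitt.e k (u 0).succPNat) * ι k _ (PositiveWitt.e k (u 1).succPNat)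

theorem toQuadratic_X_pow_mul_X_pow (p q : ℕ) :
    toQuadratic (X 0 ^ p * X 1 ^ q : MvPolynomial (Fin 2) k) =
      ι k _ (PositiveWitt.e k p.succPNat) * ι k _ (PositiveWitt.e k q.succPNat) := by
  have h : (X 0 ^ p * X 1 ^ q : MvPolynomial (Fin 2) k) =
      basisMonomials (Fin 2) k (Finsupp.single 0 p + Finsupp.single 1 q) := by
    rw [coe_basisMonomials, X_pow_eq_monomial, X_pow_eq_monomial, monomial_mul, one_mul]
  rw [h, toQuadratic, Module.Basis.constr_basis]
  simp

theorem toQuadratic_swapVars (f : MvPolynomial (Fin 2) k) :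
    toQuadratic (swapVars f) = toQuadratic f := by
  have h : LinearMap.eqLocus (toQuadratic ∘ₗ swapVars.toLinearMap) (toQuadratic (k := k)) = ⊤ := by
    refine eq_top_of_X_pow_mul_X_pow_mem fun p q => ?_
    change toQuadratic (swapVars (X 0 ^ p * X 1 ^ q)) = toQuadratic (X 0 ^ p * X 1 ^ q)
    rw [map_mul, map_pow, map_pow, swapVars_X, swapVars_X, Equiv.swap_apply_left,
      Equiv.swap_apply_right, mul_comm, toQuadratic_X_pow_mul_X_pow, toQuadratic_X_pow_mul_X_pow,
      mul_comm]
  exact Submodule.eq_top_iff'.1 h f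

theorem wittOp_adjointTwist_X_pow_mul_X_pow (n p q : ℕ) :
    wittOp adjointTwist n (X 0 ^ p * X 1 ^ q : MvPolynomial (Fin 2) k) =
      (p - n : k) • (X 0 ^ (n + p + 1) * X 1 ^ q) +
        (q - n : k) • (X 0 ^ p * X 1 ^ (n + q + 1)) := by
  simp only [wittOp_adjointTwist_apply, Fin.sum_univ_two, Derivation.leibniz, euler_X_pow,
    smul_eq_C_mul, map_sub, map_natCast, smul_eq_mul, ↓reduceIte, one_ne_zero, zero_ne_one]
  ring

/-- The polynomials that represent the quadratic elements of an ideal. -/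
def quadraticPart (I : Ideal (SymmetricAlgebra k (PositiveWitt k))) :
    Submodule k (MvPolynomial (Fin 2) k) :=
  (I.restrictScalars k).comap toQuadratic

theorem quadraticPart_mono : Monotone (quadraticPart (k := k)) :=
  fun _ _ h => Submodule.comap_mono h

theorem sub_swapVars_mem_quadraticPart (I : Ideal (SymmetricAlgebra k (PositiveWitt k)))
    (f : MvPolynomial (Fin 2) k) : f - swapVars f ∈ quadraticPart I := by
  change toQuadratic (f - swapVars f) ∈ I
  rw [map_sub, toQuadratic_swapVars, sub_self]
  exact I.zero_mem

theorem poissonSpan_le {L : Type*} [LieRing L] [LieAlgebra k L] {Y : Set (SymmetricAlgebra k L)}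
    {I : Ideal (SymmetricAlgebra k L)} (hI : IsPoissonIdeal I) (h : Y ⊆ I) : poissonSpan Y ≤ I :=
  sInf_le ⟨hI, h⟩

theorem isPoissonIdeal_of_isQuadraticallyGenerated {L : Type*} [LieRing L] [LieAlgebra k L]
    {I : Ideal (SymmetricAlgebra k L)} (hI : IsQuadraticallyGenerated I) : IsPoissonIdeal I := by
  obtain ⟨Y, -, rfl⟩ := hI
  exact isPoissonIdeal_poissonSpan Y

variable [CharZero k]

theorem toQuadratic_wittOp (n : ℕ) (f : MvPolynomial (Fin 2) k) :
    toQuadratic (wittOp adjointTwist n f) =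
      adDerivation (PositiveWitt.e k n.succPNat) (toQuadratic f) := by
  have hlie (p : ℕ) : ⁅PositiveWitt.e k n.succPNat, PositiveWitt.e k p.succPNat⁆ =
      (p - n : k) • PositiveWitt.e k (n + p + 1).succPNat := by
    refine (PositiveWitt.lieHom_e k _ _).trans ?_
    have hadd : n.succPNat + p.succPNat = (n + p + 1).succPNat := PNat.eq (by simp; omega)
    rw [hadd]
    congr 1
    simp
  have h : LinearMap.eqLocus (toQuadratic ∘ₗ wittOp adjointTwist n)
      ((adDerivation (PositiveWitt.e k n.succPNat)).toLinearMap ∘ₗ toQuadratic) = ⊤ := by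
    refine eq_top_of_X_pow_mul_X_pow_mem fun p q => ?_
    change toQuadratic (wittOp adjointTwist n (X 0 ^ p * X 1 ^ q)) =
      adDerivation (PositiveWitt.e k n.succPNat) (toQuadratic (X 0 ^ p * X 1 ^ q))
    simp only [wittOp_adjointTwist_X_pow_mul_X_pow, map_add, map_smul,
      toQuadratic_X_pow_mul_X_pow, Derivation.leibniz, adDerivation_ι, hlie, smul_eq_mul,
      mul_smul_comm]
    rw [add_comm, mul_comm (ι k _ (PositiveWitt.e k q.succPNat))]
  exact Submodule.eq_top_iff'.1 h f

theorem wittStable_quadraticPart {I : Ideal (SymmetricAlgebra k (PositiveWitt k))}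
    (hI : IsPoissonIdeal I) : WittStable adjointTwist (quadraticPart I) := by
  intro n f hf
  change toQuadratic (wittOp adjointTwist n f) ∈ I
  rw [toQuadratic_wittOp, ← poissonBracket_ι_left]
  exact hI _ _ hf

theorem homogeneousPart_two_le_range_toQuadratic :
    homogeneousPart k (PositiveWitt k) 2 ≤ LinearMap.range (toQuadratic (k := k)) := by
  have hspan : LinearMap.range (ι k (PositiveWitt k)) =
      Submodule.span k (Set.range fun i => ι k (PositiveWitt k) (PositiveWitt.e k i)) := by
    rw [LinearMap.range_eq_map, ← (PositiveWitt.e k).span_eq, Submodule.map_span,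
      ← Set.range_comp]
    rfl
  rw [homogeneousPart, pow_two, hspan, Submodule.span_mul_span, Submodule.span_le]
  rintro _ ⟨_, ⟨i, rfl⟩, _, ⟨j, rfl⟩, rfl⟩
  refine ⟨X 0 ^ i.natPred * X 1 ^ j.natPred, ?_⟩
  rw [toQuadratic_X_pow_mul_X_pow, PNat.succPNat_natPred, PNat.succPNat_natPred]

theorem le_of_quadraticPart_le {I J : Ideal (SymmetricAlgebra k (PositiveWitt k))}
    (hI : IsQuadraticallyGenerated I) (hJ : IsPoissonIdeal J)
    (h : quadraticPart I ≤ quadraticPart J) : I ≤ J := by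
  obtain ⟨Y, hY, rfl⟩ := hI
  refine poissonSpan_le hJ fun a ha => ?_
  obtain ⟨f, rfl⟩ := homogeneousPart_two_le_range_toQuadratic (hY ha)
  exact @h f (subset_poissonSpan Y ha)

end Quadratic

end WittQuadratic

end

/-- The ascending chain condition on the Poisson ideals of the symmetric algebra of the positive
Witt algebra that are generated by quadratic elements. -/
theorem corollary4p4 (k : Type*) [Field k] [CharZero k]
    (I : ℕ → Ideal (SymmetricAlgebra k (PositiveWitt k)))
    (hI : ∀ n, SymmetricAlgebra.IsQuadraticallyGenerated (I n))
    (hmono : ∀ n, I n ≤ I (n + 1)) :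
    ∃ N, ∀ n, N ≤ n → I n = I N := by
  have hP n := WittQuadratic.isPoissonIdeal_of_isQuadraticallyGenerated (hI n)
  have hmono' : Monotone I := monotone_nat_of_le_succ hmono
  have hconst := WittQuadratic.eventuallyConst_of_wittStable
    (WittQuadratic.quadraticPart_mono.comp hmono')
    (fun m => WittQuadratic.wittStable_quadraticPart (hP m))
    (fun m => WittQuadratic.sub_swapVars_mem_quadraticPart (I m))
  obtain ⟨N, hN⟩ := Filter.eventuallyConst_atTop.1 hconst
  exact ⟨N, fun n hn => le_antisymm
    (WittQuadratic.le_of_quadraticPart_le (hI n) (hP N) (hN n hn).le) (hmono' hn)⟩
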